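/- For an integer $n\ge 1$ let $P_n=\sum_{i=1}^n i^2$ be the $n$-th square pyramidal number, let $y_n^2$ (with $y_n\ge 0$ an integer) be the perfect square closest to $P_n$, and let $a_n=|P_n-y_n^2|$. For real $x\ge 1$ put $$A(x)=\frac1x\sum_{1\le n\le x}a_n .$$ Then, for real $x\ge 1$, $$A(x)=\frac{1}{5\sqrt3}\,x^{3/2}+O\!\left(x^{17/12}\right),$$ where the implied constant is absolute; that is, there is a constant $C>0$ such that $\left|A(x)-\frac{1}{5\sqrt3}x^{3/2}\right|\le C\,x^{17/12}$ for all real $x\ge 1$. -/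

import Mathlib

/-- The `n`-th square pyramidal number `P_n = 1² + 2² + ⋯ + n²`. -/
def squarePyramidal (n : ℕ) : ℕ :=
  ∑ i ∈ Finset.Icc 1 n, i ^ 2

theorem six_mul_squarePyramidal (n : ℕ) :
    6 * squarePyramidal n = 2 * n ^ 3 + 3 * n ^ 2 + n := by
  induction n with
  | zero => simp [squarePyramidal]
  | succ k ih =>
    have h : squarePyramidal (k + 1) = squarePyramidal k + (k + 1) ^ 2 := by
      simp [squarePyramidal, Finset.sum_Icc_succ_top]
    rw [h, mul_add, ih]
    ring

/-- The non-negative integer `y` whose square is closest to `p`, that is, the minimizer of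
`|p - y²|` over all `y : ℕ`. -/
noncomputable def closestRoot (p : ℕ) : ℕ :=
  Function.argmin (fun y : ℕ => |(p : ℤ) - (y : ℤ) ^ 2|.toNat)

theorem closestRoot_le (p m : ℕ) :
    |(p : ℤ) - (closestRoot p : ℤ) ^ 2| ≤ |(p : ℤ) - (m : ℤ) ^ 2| := by
  have h := Function.argmin_le (fun y : ℕ => |(p : ℤ) - (y : ℤ) ^ 2|.toNat) m
  have h2 := abs_nonneg ((p : ℤ) - (m : ℤ) ^ 2)
  have h' : |(p : ℤ) - (closestRoot p : ℤ) ^ 2|.toNat ≤ |(p : ℤ) - (m : ℤ) ^ 2|.toNat := h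
  omega

/-- The closest square to `p` is unique. -/
theorem eq_closestRoot (p y : ℕ)
    (hy : ∀ m : ℕ, |(p : ℤ) - (y : ℤ) ^ 2| ≤ |(p : ℤ) - (m : ℤ) ^ 2|) :
    y = closestRoot p := by
  have key : ∀ a b : ℕ, (∀ m : ℕ, |(p : ℤ) - (a : ℤ) ^ 2| ≤ |(p : ℤ) - (m : ℤ) ^ 2|) →
      (∀ m : ℕ, |(p : ℤ) - (b : ℤ) ^ 2| ≤ |(p : ℤ) - (m : ℤ) ^ 2|) → a < b → False := by
    intro a b ha hb hab
    have h1 := ha b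
    have h2 := hb a
    have heq := le_antisymm h1 h2
    have hlt : (a : ℤ) ^ 2 < (b : ℤ) ^ 2 := by
      have : (a : ℤ) < b := by exact_mod_cast hab
      have : (0 : ℤ) ≤ a := by positivity
      nlinarith
    -- equality of the distances places `p` halfway between the two squares
    have hmid : 2 * (p : ℤ) = (a : ℤ) ^ 2 + (b : ℤ) ^ 2 := by
      rcases abs_eq_abs.mp heq with h | h <;> linarith
    have h3 := ha (a + 1)
    push_cast at h3
    rw [abs_of_nonneg (by linarith)] at h3
    rcases Nat.lt_or_ge (a + 1) b with hc | hc
    · have hc' : (a : ℤ) + 1 + 1 ≤ b := by exact_mod_cast hc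
      have ha0 : (0 : ℤ) ≤ a := by positivity
      rw [abs_of_nonneg (by nlinarith)] at h3
      nlinarith
    · have hb' : (b : ℤ) = a + 1 := by
        have : b = a + 1 := by omega
        exact_mod_cast this
      rw [hb'] at hmid
      have : 2 * (p : ℤ) = 2 * ((a : ℤ) ^ 2 + a) + 1 := by rw [hmid]; ring
      omega
  rcases lt_trichotomy y (closestRoot p) with h | h | h
  · exact (key _ _ hy (closestRoot_le p) h).elim
  · exact h
  · exact (key _ _ (closestRoot_le p) hy h).elim

/-- `a_n = |P_n - y_n²|`, the distance from `P_n` to its closest square `y_n²`. -/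
noncomputable def cannonballDist (n : ℕ) : ℝ :=
  |(squarePyramidal n : ℝ) - (closestRoot (squarePyramidal n) : ℝ) ^ 2|

/-- `A(x) = (1 / x) ∑_{1 ≤ n ≤ x} a_n`. -/
noncomputable def cannonballAverage (x : ℝ) : ℝ :=
  (1 / x) * ∑ n ∈ Finset.Icc 1 ⌊x⌋₊, cannonballDist n

/-! Write `g n = pyramidalRoot n`. Since `g n ^ 2` exceeds `P_n` by only `(n + 1/2) / 12`, `a_n`
equals `2 * g n * distInt (g n)` up to `O(n)`. If `distInt` is replaced by its mean `1/4`, the sum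
of `(1/2) g n` over `n < N` is `N^(5/2) / (5√3)` up to `O(N^(3/2))`. What remains is
equidistribution of `g n` mod 1: `exists_abs_sum_distInt_sub_quarter_le` saves `N^(1/12)`, and Abel
summation against the weight `g n` gives `N^(3/2 + 11/12) = N^(29/12)`, hence `x^(17/12)` after
division by `x`.

For equidistribution, `distInt - 1/4` is a combination of periodic second Bernoulli functions, whose
cosine series has coefficients of size `1/h^2`. Weyl differencing
(`mul_norm_sum_le_of_correlation_le`) bounds the sum of `exp (iω(n + 1/2)^(3/2))` by `O(√ω
N^(11/12))`: shifted products have phase close to `θ√(n + 1/2)`, and such sums nearly telescope. The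
loss of `√h` leaves the summable series `∑ h^(-3/2)`, so the Fourier series needs no truncation. -/

/-! ### Exponential sums with phase `θ√(n + 1/2)` -/

/-- The unit complex number `exp (i t)`. -/
noncomputable def cis (t : ℝ) : ℂ := Complex.exp (Complex.I * t)

theorem norm_cis (t : ℝ) : ‖cis t‖ = 1 := Complex.norm_exp_I_mul_ofReal t

theorem cis_add (s t : ℝ) : cis (s + t) = cis s * cis t := by
  simp only [cis, ← Complex.exp_add]
  push_cast
  ring_nf

theorem conj_cis (t : ℝ) : (starRingEnd ℂ) (cis t) = cis (-t) := by
  simp only [cis, ← Complex.exp_conj]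
  simp

theorem cis_re (t : ℝ) : (cis t).re = Real.cos t := by
  rw [cis, mul_comm, Complex.exp_ofReal_mul_I_re]

theorem norm_cis_sub_one_le (t : ℝ) : ‖cis t - 1‖ ≤ |t| :=
  Real.norm_exp_I_mul_ofReal_sub_one_le

theorem norm_cis_sub_cis_le (s t : ℝ) : ‖cis s - cis t‖ ≤ |s - t| := by
  have h : cis s - cis t = cis t * (cis (s - t) - 1) := by
    rw [mul_sub, ← cis_add, mul_one]
    congr 2
    ring
  rw [h, norm_mul, norm_cis, one_mul]
  exact norm_cis_sub_one_le _

theorem norm_cis_sub_one_sub_le (t : ℝ) : ‖cis t - 1 - Complex.I * t‖ ≤ 2 * t ^ 2 := by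
  have hn : ‖Complex.I * (t : ℂ)‖ = |t| := by simp
  rcases le_total |t| 1 with h | h
  · have := Complex.norm_exp_sub_one_sub_id_le (x := Complex.I * t) (by rw [hn]; exact h)
    rw [hn, sq_abs] at this
    have h2 := sq_nonneg t
    unfold cis
    linarith
  · have h1 := norm_sub_le (cis t - 1) (Complex.I * t)
    have h2 := norm_cis_sub_one_le t
    rw [hn] at h1
    have h3 : |t| ≤ t ^ 2 := by rw [← sq_abs]; nlinarith
    linarith

/-- The increment `√(n + 3/2) - √(n + 1/2)`. -/
noncomputable def sqrtIncr (n : ℕ) : ℝ := √((n : ℝ) + 3 / 2) - √((n : ℝ) + 1 / 2)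

theorem sqrtIncr_nonneg (n : ℕ) : 0 ≤ sqrtIncr n :=
  sub_nonneg.2 (Real.sqrt_le_sqrt (by linarith))

theorem sum_sqrtIncr (N : ℕ) :
    ∑ n ∈ Finset.range N, sqrtIncr n = √((N : ℝ) + 1 / 2) - √(1 / 2) := by
  have h := Finset.sum_range_sub (fun n : ℕ => √((n : ℝ) + 1 / 2)) N
  simp only [Nat.cast_zero, zero_add] at h
  rw [← h]
  refine Finset.sum_congr rfl fun n _ => ?_
  rw [sqrtIncr]
  push_cast
  ring_nf

theorem sum_sqrtIncr_le (N : ℕ) : ∑ n ∈ Finset.range N, sqrtIncr n ≤ √N := by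
  rw [sum_sqrtIncr]
  have h : √((N : ℝ) + 1 / 2) ≤ √N + √(1 / 2) := by
    refine Real.sqrt_le_iff.2 ⟨by positivity, ?_⟩
    rw [add_sq, Real.sq_sqrt (by positivity), Real.sq_sqrt (by positivity)]
    have : 0 ≤ 2 * √(N : ℝ) * √(1 / 2) := by positivity
    linarith
  linarith

/-- The step of the telescoping behind `norm_sum_cis_sqrt_le`, with `p`, `q` consecutive roots. -/
theorem norm_mul_cis_sub_le {p q θ : ℝ} (hp : 0 < p) (hpq : q ^ 2 = p ^ 2 + 1) (hq : 0 < q)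
    (hθ : 1 ≤ θ) :
    ‖q * cis (θ * q) - p * cis (θ * p) - Complex.I * (θ / 2 : ℝ) * cis (θ * p)‖
      ≤ 4 * θ ^ 2 * (q - p) := by
  set δ := q - p with hδ
  have h1 : δ * (q + p) = 1 := by rw [hδ]; linarith
  have hδ0 : 0 < δ := by
    by_contra h
    nlinarith
  have hqδ : q * δ ≤ 1 := by nlinarith
  have hδ1 : δ ≤ 1 := by nlinarith
  -- This turns the first-order term `iθqδ` into the main term `iθ/2`, up to a multiple of `δ ^ 2`.
  have hhalf : q * δ = 1 / 2 + δ ^ 2 / 2 := by nlinarith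
  have hq1 : cis (θ * q) = cis (θ * p) * cis (θ * δ) := by
    rw [← cis_add]; congr 1; rw [hδ]; ring
  have key : (q : ℂ) * cis (θ * q) - p * cis (θ * p) - Complex.I * (θ / 2 : ℝ) * cis (θ * p)
      = cis (θ * p) * ((δ : ℝ) + Complex.I * ((θ * δ ^ 2 / 2 : ℝ) : ℂ)
        + q * (cis (θ * δ) - 1 - Complex.I * (θ * δ : ℝ))) := by
    have h2 : (q : ℂ) * δ = 1 / 2 + (δ : ℂ) ^ 2 / 2 := by
      have := congrArg (fun t : ℝ => (t : ℂ)) hhalf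
      push_cast at this
      exact this
    have h3 : (δ : ℂ) = q - p := by rw [hδ]; push_cast; ring
    rw [hq1]
    push_cast
    linear_combination (cis (θ * p) * Complex.I * θ) * h2 + (-cis (θ * p)) * h3
  rw [key, norm_mul, norm_cis, one_mul]
  have e1 : ‖((δ : ℝ) : ℂ)‖ = δ := by rw [Complex.norm_real, Real.norm_of_nonneg hδ0.le]
  have e2 : ‖Complex.I * ((θ * δ ^ 2 / 2 : ℝ) : ℂ)‖ = θ * δ ^ 2 / 2 := by
    rw [norm_mul, Complex.norm_I, one_mul, Complex.norm_real, Real.norm_of_nonneg (by positivity)]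
  have e3 : ‖(q : ℂ) * (cis (θ * δ) - 1 - Complex.I * (θ * δ : ℝ))‖ ≤ q * (2 * (θ * δ) ^ 2) := by
    rw [norm_mul, Complex.norm_real, Real.norm_of_nonneg hq.le]
    exact mul_le_mul_of_nonneg_left (norm_cis_sub_one_sub_le _) hq.le
  refine (norm_add_le _ _).trans ((add_le_add_left (norm_add_le _ _) _).trans ?_)
  rw [e1, e2]
  have hθ2 : θ ≤ θ ^ 2 := by nlinarith
  have f1 : q * (2 * (θ * δ) ^ 2) ≤ 2 * θ ^ 2 * δ := by
    have : q * (2 * (θ * δ) ^ 2) = 2 * θ ^ 2 * δ * (q * δ) := by ring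
    rw [this]
    exact mul_le_of_le_one_right (by positivity) hqδ
  have f2 : θ * δ ^ 2 / 2 ≤ θ ^ 2 * δ / 2 := by
    have : δ ^ 2 ≤ δ := by nlinarith
    have : θ * δ ^ 2 ≤ θ ^ 2 * δ := by gcongr
    linarith
  have f3 : δ ≤ θ ^ 2 * δ := le_mul_of_one_le_left hδ0.le (by nlinarith)
  nlinarith [mul_nonneg (sq_nonneg θ) hδ0.le]

/-- The derivative of `√u * cis (θ√u)` is `(iθ/2) * cis (θ√u)` up to `O(1/√u)`, so the sum
telescopes. Errors are kept as multiples of `sqrtIncr n`, which telescope too. -/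
theorem norm_sum_cis_sqrt_le {θ : ℝ} (hθ : 1 ≤ θ) (N : ℕ) :
    ‖∑ n ∈ Finset.range N, cis (θ * √((n : ℝ) + 1 / 2))‖ ≤ 14 * θ * √N := by
  rcases Nat.eq_zero_or_pos N with rfl | hN
  · simp
  have hN1 : (1 : ℝ) ≤ N := by exact_mod_cast hN
  set G : ℕ → ℂ := fun n => (√((n : ℝ) + 1 / 2) : ℂ) * cis (θ * √((n : ℝ) + 1 / 2)) with hG
  have hstep : ∀ n ∈ Finset.range N,
      ‖G (n + 1) - G n - Complex.I * (θ / 2 : ℝ) * cis (θ * √((n : ℝ) + 1 / 2))‖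
        ≤ 4 * θ ^ 2 * sqrtIncr n := by
    intro n _
    have h32 : ((n + 1 : ℕ) : ℝ) + 1 / 2 = (n : ℝ) + 3 / 2 := by push_cast; ring
    simp only [hG, h32]
    refine norm_mul_cis_sub_le (by positivity) ?_ (by positivity) hθ
    rw [Real.sq_sqrt (by positivity), Real.sq_sqrt (by positivity)]
    ring
  have hsum := (norm_sum_le _ _).trans (Finset.sum_le_sum hstep)
  rw [Finset.sum_sub_distrib, Finset.sum_range_sub, ← Finset.mul_sum, ← Finset.mul_sum] at hsum
  have hδ := mul_le_mul_of_nonneg_left (sum_sqrtIncr_le N) (show 0 ≤ 4 * θ ^ 2 by positivity)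
  have hnG : ∀ n, ‖G n‖ = √((n : ℝ) + 1 / 2) := by
    intro n
    simp only [hG]
    rw [norm_mul, norm_cis, mul_one, Complex.norm_real, Real.norm_of_nonneg (Real.sqrt_nonneg _)]
  set S := ∑ n ∈ Finset.range N, cis (θ * √((n : ℝ) + 1 / 2)) with hS
  have hIS : ‖Complex.I * ((θ / 2 : ℝ) : ℂ) * S‖ = θ / 2 * ‖S‖ := by
    rw [norm_mul, norm_mul, Complex.norm_I, one_mul, Complex.norm_real,
      Real.norm_of_nonneg (by positivity)]
  have htri : θ / 2 * ‖S‖ ≤ ‖G N‖ + ‖G 0‖ + 4 * θ ^ 2 * √N := by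
    rw [← hIS]
    have a1 := norm_sub_le (G N - G 0) (G N - G 0 - Complex.I * ((θ / 2 : ℝ) : ℂ) * S)
    rw [sub_sub_cancel] at a1
    have a2 := norm_sub_le (G N) (G 0)
    linarith
  rw [hnG, hnG] at htri
  -- The three terms of `htri` give `2 + 1 + 4 = 7` times `θ ^ 2 * √N`; division by `θ / 2` makes
  -- `14 * θ * √N`.
  have g1 : √((N : ℝ) + 1 / 2) ≤ 2 * √N := by
    rw [show (2 : ℝ) * √N = √(4 * N) by
      rw [Real.sqrt_mul (by norm_num), show (4 : ℝ) = 2 ^ 2 by norm_num,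
        Real.sqrt_sq (by norm_num)]]
    exact Real.sqrt_le_sqrt (by linarith)
  have g2 : √(((0 : ℕ) : ℝ) + 1 / 2) ≤ √N := Real.sqrt_le_sqrt (by push_cast; linarith)
  have hs := Real.sqrt_nonneg (N : ℝ)
  have hθs : √(N : ℝ) ≤ θ ^ 2 * √N := le_mul_of_one_le_left hs (by nlinarith)
  have : θ / 2 * ‖S‖ ≤ θ / 2 * (14 * θ * √N) := by
    calc _ ≤ 7 * (θ ^ 2 * √N) := by linarith
      _ = _ := by ring
  exact le_of_mul_le_mul_left this (by positivity)

/-! ### Weyl differencing and the phase `ω(n + 1/2)^(3/2)` -/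

/-- Weyl differencing: correlations bound an exponential sum. -/
theorem mul_norm_sum_le_of_correlation_le {z : ℕ → ℂ} (hz : ∀ n, ‖z n‖ = 1) (N L : ℕ) {T : ℝ}
    (hT0 : 0 ≤ T)
    (hT : ∀ m < L, ∀ m' < L, m ≠ m' →
      ‖∑ n ∈ Finset.range N, z (n + m) * (starRingEnd ℂ) (z (n + m'))‖ ≤ T) :
    L * ‖∑ n ∈ Finset.range N, z n‖ ≤ 2 * L ^ 2 + √(N * (N * L + L ^ 2 * T)) := by
  set S := ∑ n ∈ Finset.range N, z n with hS
  set w : ℕ → ℂ := fun n => ∑ m ∈ Finset.range L, z (n + m) with hw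
  -- A shift by `m` changes at most `m` terms at each end.
  have hshift : ∀ m, ‖S - ∑ n ∈ Finset.range N, z (n + m)‖ ≤ 2 * m := by
    intro m
    have h1 : ∑ n ∈ Finset.range (N + m), z n =
        ∑ n ∈ Finset.range m, z n + ∑ n ∈ Finset.range N, z (n + m) := by
      rw [add_comm N m, Finset.sum_range_add]
      simp only [add_comm m]
    have h2 := Finset.sum_range_add z N m
    have h3 : S - ∑ n ∈ Finset.range N, z (n + m) =
        ∑ n ∈ Finset.range m, z n - ∑ n ∈ Finset.range m, z (N + n) := by
      rw [h1, ← hS] at h2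
      linear_combination -h2
    have hb : ∀ f : ℕ → ℂ, (∀ n, ‖f n‖ = 1) → ‖∑ n ∈ Finset.range m, f n‖ ≤ m := by
      intro f hf
      refine (norm_sum_le _ _).trans ?_
      simp [hf]
    rw [h3]
    have := norm_sub_le (∑ n ∈ Finset.range m, z n) (∑ n ∈ Finset.range m, z (N + n))
    have := hb z hz
    have := hb (fun n => z (N + n)) fun n => hz _
    linarith
  have hLS : ‖(L : ℂ) * S - ∑ n ∈ Finset.range N, w n‖ ≤ 2 * L ^ 2 := by
    have h1 : (L : ℂ) * S - ∑ n ∈ Finset.range N, w n =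
        ∑ m ∈ Finset.range L, (S - ∑ n ∈ Finset.range N, z (n + m)) := by
      rw [Finset.sum_sub_distrib, Finset.sum_comm]
      simp
    rw [h1]
    refine (norm_sum_le _ _).trans ?_
    calc _ ≤ ∑ m ∈ Finset.range L, (2 * L : ℝ) := by
          refine Finset.sum_le_sum fun m hm => (hshift m).trans ?_
          have : (m : ℝ) ≤ L := by exact_mod_cast (Finset.mem_range.1 hm).le
          linarith
      _ = _ := by simp; ring
  have hCS : ‖∑ n ∈ Finset.range N, w n‖ ^ 2 ≤ N * ∑ n ∈ Finset.range N, ‖w n‖ ^ 2 := by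
    have h1 := sq_sum_le_card_mul_sum_sq (s := Finset.range N) (f := fun n => ‖w n‖)
    rw [Finset.card_range] at h1
    exact (pow_le_pow_left₀ (norm_nonneg _) (norm_sum_le _ _) 2).trans h1
  have hexp : ((∑ n ∈ Finset.range N, ‖w n‖ ^ 2 : ℝ) : ℂ) =
      ∑ m ∈ Finset.range L, ∑ m' ∈ Finset.range L,
        ∑ n ∈ Finset.range N, z (n + m) * (starRingEnd ℂ) (z (n + m')) := by
    push_cast
    have : ∀ n, ((‖w n‖ : ℂ)) ^ 2 = ∑ m ∈ Finset.range L, ∑ m' ∈ Finset.range L,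
        z (n + m) * (starRingEnd ℂ) (z (n + m')) := by
      intro n
      rw [← Complex.mul_conj', hw]
      simp only [map_sum]
      rw [Finset.sum_mul_sum]
    simp only [this]
    rw [Finset.sum_comm]
    exact Finset.sum_congr rfl fun m _ => Finset.sum_comm
  have hw2 : ∑ n ∈ Finset.range N, ‖w n‖ ^ 2 ≤ N * L + L ^ 2 * T := by
    have h0 : 0 ≤ ∑ n ∈ Finset.range N, ‖w n‖ ^ 2 := Finset.sum_nonneg fun _ _ => sq_nonneg _
    have h1 : ∑ n ∈ Finset.range N, ‖w n‖ ^ 2 =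
        ‖((∑ n ∈ Finset.range N, ‖w n‖ ^ 2 : ℝ) : ℂ)‖ := by
      rw [Complex.norm_real, Real.norm_of_nonneg h0]
    rw [h1, hexp]
    refine (norm_sum_le _ _).trans ?_
    calc _ ≤ ∑ m ∈ Finset.range L, (N + L * T : ℝ) := by
          refine Finset.sum_le_sum fun m hm => (norm_sum_le _ _).trans ?_
          -- The diagonal costs `N`; allowing `T` there as well keeps the count uniform.
          calc _ ≤ ∑ m' ∈ Finset.range L, ((if m = m' then (N : ℝ) else 0) + T) := by
                refine Finset.sum_le_sum fun m' hm' => ?_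
                split_ifs with h
                · refine (norm_sum_le _ _).trans ?_
                  simp [hz, hT0]
                · rw [zero_add]
                  exact hT m (Finset.mem_range.1 hm) m' (Finset.mem_range.1 hm') h
            _ = _ := by
                rw [Finset.sum_add_distrib, Finset.sum_ite_eq, if_pos hm]
                simp
      _ = _ := by simp; ring
  have hsq : ‖∑ n ∈ Finset.range N, w n‖ ≤ √(N * (N * L + L ^ 2 * T)) :=
    Real.le_sqrt_of_sq_le (hCS.trans (mul_le_mul_of_nonneg_left hw2 (by positivity)))
  have hL : ‖(L : ℂ) * S‖ = L * ‖S‖ := by rw [norm_mul, Complex.norm_natCast]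
  have h1 := norm_sub_norm_le ((L : ℂ) * S) (∑ n ∈ Finset.range N, w n)
  rw [hL] at h1
  linarith

/-- The function `t ^ (3/2)`. -/
noncomputable def powThreeHalves (t : ℝ) : ℝ := t * √t

/-- The second-order Taylor error is about `m ^ 2 / √u`; stating it through `sqrtIncr n` makes its
sum over `n` at most `m ^ 2 * √N`. -/
theorem powThreeHalves_linearization {u : ℝ} {n : ℕ} (hu : u = (n : ℝ) + 1 / 2) (m : ℕ) :
    0 ≤ powThreeHalves (u + m) - powThreeHalves u - 3 / 2 * m * √u ∧
    powThreeHalves (u + m) - powThreeHalves u - 3 / 2 * m * √u ≤ m ^ 2 * sqrtIncr n := by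
  have hu0 : 0 < u := by rw [hu]; positivity
  rcases Nat.eq_zero_or_pos m with rfl | hm
  · simp
  have hm1 : (1 : ℝ) ≤ m := by exact_mod_cast hm
  set p := √u with hp
  set q := √(u + m) with hq
  set r := √(u + 1) with hr
  have hp0 : 0 < p := Real.sqrt_pos.2 hu0
  have hq0 : 0 < q := Real.sqrt_pos.2 (by linarith)
  have hr0 : 0 < r := Real.sqrt_pos.2 (by linarith)
  have hrq : r ≤ q := Real.sqrt_le_sqrt (by linarith)
  have hpr : p ≤ r := Real.sqrt_le_sqrt (by linarith)
  have hp2 : p ^ 2 = u := Real.sq_sqrt hu0.le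
  have hq2 : q ^ 2 = u + m := Real.sq_sqrt (by linarith)
  have hr2 : r ^ 2 = u + 1 := Real.sq_sqrt (by linarith)
  have hincr : sqrtIncr n = r - p := by
    rw [sqrtIncr, hr, hp, hu]; ring_nf
  have hmq : (m : ℝ) = q ^ 2 - p ^ 2 := by linarith
  have hexp : powThreeHalves (u + m) - powThreeHalves u - 3 / 2 * m * p =
      (q - p) ^ 2 * (q + p / 2) := by
    rw [powThreeHalves, powThreeHalves, ← hp, ← hq, ← hp2, hmq]
    ring_nf
  rw [hexp, hincr]
  refine ⟨by positivity, ?_⟩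
  have h1 : (r - p) * (r + p) = 1 := by linarith
  -- From `(q + p) * (r - p) ≥ (r + p) * (r - p) = 1`.
  have h2 : (q + p / 2) ≤ (q + p) ^ 2 * (r - p) := by
    have : 1 ≤ (q + p) * (r - p) := by
      rw [← h1, mul_comm (q + p)]
      exact mul_le_mul_of_nonneg_left (by linarith) (by linarith)
    nlinarith
  calc (q - p) ^ 2 * (q + p / 2) ≤ (q - p) ^ 2 * ((q + p) ^ 2 * (r - p)) := by gcongr
    _ = _ := by rw [hmq]; ring

/-- Linearizing both phases leaves `θ√u` with `θ = (3/2)ω(m - m')`, plus a term independent of `n`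
that is zero. The model sum contributes `14 * 3/2 = 21`, the linearization `1`. -/
theorem norm_correlation_le {ω : ℝ} (hω : 1 ≤ ω) (N L m m' : ℕ) (hm : m < L) (hm' : m' < L)
    (hne : m ≠ m') :
    ‖∑ n ∈ Finset.range N, cis (ω * powThreeHalves (((n + m : ℕ) : ℝ) + 1 / 2)) *
      (starRingEnd ℂ) (cis (ω * powThreeHalves (((n + m' : ℕ) : ℝ) + 1 / 2)))‖
      ≤ 22 * ω * L ^ 2 * √N := by
  wlog hlt : m' < m generalizing m m'
  · have := this m' m hm' hm hne.symm (by omega)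
    rw [← RCLike.norm_conj, map_sum] at this
    simpa only [map_mul, Complex.conj_conj, mul_comm] using this
  have hL1 : (1 : ℝ) ≤ L := by exact_mod_cast (by omega : 1 ≤ L)
  have hkL : (m : ℝ) - m' ≤ L := by
    have : (m : ℝ) ≤ L := by exact_mod_cast hm.le
    have : (0 : ℝ) ≤ m' := by positivity
    linarith
  have hk1 : (1 : ℝ) ≤ (m : ℝ) - m' := by
    have : (m' : ℝ) + 1 ≤ m := by exact_mod_cast hlt
    linarith
  set θ : ℝ := ω * (3 / 2) * ((m : ℝ) - m') with hθ
  have hθ1 : 1 ≤ θ := by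
    rw [hθ]; nlinarith
  have hA := norm_sum_cis_sqrt_le hθ1 N
  have hB : ∀ n ∈ Finset.range N,
      ‖cis (ω * powThreeHalves (((n + m : ℕ) : ℝ) + 1 / 2)) *
        (starRingEnd ℂ) (cis (ω * powThreeHalves (((n + m' : ℕ) : ℝ) + 1 / 2))) -
        cis (θ * √((n : ℝ) + 1 / 2))‖ ≤ ω * L ^ 2 * sqrtIncr n := by
    intro n _
    rw [conj_cis, ← cis_add]
    refine (norm_cis_sub_cis_le _ _).trans ?_
    obtain ⟨a1, a2⟩ := powThreeHalves_linearization (n := n) rfl m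
    obtain ⟨b1, b2⟩ := powThreeHalves_linearization (n := n) rfl m'
    have hi := sqrtIncr_nonneg n
    have hLm : (m : ℝ) ^ 2 * sqrtIncr n ≤ L ^ 2 * sqrtIncr n := by
      gcongr
    have hLm' : (m' : ℝ) ^ 2 * sqrtIncr n ≤ L ^ 2 * sqrtIncr n := by
      gcongr
    set u : ℝ := (n : ℝ) + 1 / 2 with hu
    have e1 : ((n + m : ℕ) : ℝ) + 1 / 2 = u + m := by rw [hu]; push_cast; ring
    have e2 : ((n + m' : ℕ) : ℝ) + 1 / 2 = u + m' := by rw [hu]; push_cast; ring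
    rw [e1, e2]
    have e3 : ω * powThreeHalves (u + m) + -(ω * powThreeHalves (u + m')) - θ * √u =
        ω * ((powThreeHalves (u + m) - powThreeHalves u - 3 / 2 * m * √u) -
          (powThreeHalves (u + m') - powThreeHalves u - 3 / 2 * m' * √u)) := by
      rw [hθ]; ring
    rw [e3, abs_mul, abs_of_nonneg (by linarith : 0 ≤ ω), mul_assoc ω (_ ^ 2)]
    refine mul_le_mul_of_nonneg_left ?_ (by linarith)
    -- Both errors lie in `[0, L ^ 2 * sqrtIncr n]`, hence so does the absolute value of their
    -- difference.
    rw [abs_le]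
    constructor <;> linarith
  have hC := (norm_sum_le _ _).trans (Finset.sum_le_sum hB)
  rw [Finset.sum_sub_distrib, ← Finset.mul_sum] at hC
  have hD := mul_le_mul_of_nonneg_left (sum_sqrtIncr_le N) (show 0 ≤ ω * L ^ 2 by positivity)
  have hE := norm_sub_norm_le (∑ n ∈ Finset.range N,
    cis (ω * powThreeHalves (((n + m : ℕ) : ℝ) + 1 / 2)) *
      (starRingEnd ℂ) (cis (ω * powThreeHalves (((n + m' : ℕ) : ℝ) + 1 / 2))))
      (∑ n ∈ Finset.range N, cis (θ * √((n : ℝ) + 1 / 2)))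
  have hs := Real.sqrt_nonneg (N : ℝ)
  have hF : 14 * θ * √N ≤ 21 * (ω * L ^ 2 * √N) := by
    have : θ ≤ ω * (3 / 2) * L ^ 2 := by
      rw [hθ]
      refine mul_le_mul_of_nonneg_left ?_ (by linarith)
      nlinarith
    nlinarith
  linarith

theorem norm_sum_cis_powThreeHalves_le {ω : ℝ} (hω : 1 ≤ ω) {N : ℕ} (hN : 0 < N) :
    ‖∑ n ∈ Finset.range N, cis (ω * powThreeHalves ((n : ℝ) + 1 / 2))‖
      ≤ 14 * √ω * (N : ℝ) ^ (11 / 12 : ℝ) := by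
  have hN1 : (1 : ℝ) ≤ N := by exact_mod_cast hN
  have hN0 : (0 : ℝ) < N := by linarith
  set x : ℝ := (N : ℝ) ^ (1 / 12 : ℝ) with hx
  have hx1 : 1 ≤ x := Real.one_le_rpow hN1 (by norm_num)
  have hxk : ∀ k : ℕ, x ^ k = (N : ℝ) ^ ((k : ℝ) / 12) := by
    intro k
    rw [hx, ← Real.rpow_natCast, ← Real.rpow_mul hN0.le]
    ring_nf
  have hx12 : x ^ 12 = N := by rw [hxk]; norm_num
  have hx11 : x ^ 11 = (N : ℝ) ^ (11 / 12 : ℝ) := by rw [hxk]; norm_num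
  have hsN : √(N : ℝ) = x ^ 6 := by
    rw [← hx12, show x ^ 12 = (x ^ 6) ^ 2 by ring, Real.sqrt_sq (by positivity)]
  -- `L ≈ N^(1/6)` balances the diagonal `N * L` against the off-diagonal `L ^ 4 * √N`, ignoring
  -- `ω`.
  set L := ⌈x ^ 2⌉₊ with hL
  have hLx : x ^ 2 ≤ L := Nat.le_ceil _
  have hLx' : (L : ℝ) ≤ 2 * x ^ 2 := by
    have := Nat.ceil_lt_add_one (show 0 ≤ x ^ 2 by positivity)
    nlinarith
  have hL0 : (0 : ℝ) < L := by nlinarith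
  have h := mul_norm_sum_le_of_correlation_le
    (z := fun n => cis (ω * powThreeHalves ((n : ℝ) + 1 / 2))) (fun n => norm_cis _) N L
    (T := 22 * ω * L ^ 2 * √N) (by positivity)
    (fun m hm m' hm' hne => norm_correlation_le hω N L m m' hm hm' hne)
  rw [hsN, ← hx12] at h
  have hroot : √(x ^ 12 * (x ^ 12 * L + L ^ 2 * (22 * ω * L ^ 2 * x ^ 6))) ≤
      L * (10 * √ω * x ^ 11) := by
    apply Real.sqrt_le_iff.2 ⟨by positivity, ?_⟩
    have e : (L * (10 * √ω * x ^ 11)) ^ 2 = (L : ℝ) ^ 2 * (100 * ω * x ^ 22) := by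
      rw [mul_pow, mul_pow, mul_pow, Real.sq_sqrt (by linarith)]; ring
    rw [e]
    have t1 : x ^ 12 * (x ^ 12 * (L : ℝ)) ≤ (L : ℝ) ^ 2 * (ω * x ^ 22) := by
      calc x ^ 12 * (x ^ 12 * (L : ℝ)) = L * x ^ 2 * (1 * x ^ 22) := by ring
        _ ≤ L * L * (ω * x ^ 22) := by gcongr
        _ = _ := by ring
    have t2 : x ^ 12 * ((L : ℝ) ^ 2 * (22 * ω * L ^ 2 * x ^ 6)) ≤
        (L : ℝ) ^ 2 * (88 * ω * x ^ 22) := by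
      calc x ^ 12 * ((L : ℝ) ^ 2 * (22 * ω * L ^ 2 * x ^ 6))
          ≤ x ^ 12 * ((L : ℝ) ^ 2 * (22 * ω * (2 * x ^ 2) ^ 2 * x ^ 6)) := by gcongr
        _ = _ := by ring
    have t3 : 0 ≤ (L : ℝ) ^ 2 * (ω * x ^ 22) := by positivity
    linarith
  rw [← hx11]
  have hω1 : 1 ≤ √ω := Real.one_le_sqrt.2 hω
  have hlow : 2 * (L : ℝ) ^ 2 ≤ L * (4 * √ω * x ^ 11) := by
    have : (x : ℝ) ^ 2 ≤ x ^ 11 := pow_le_pow_right₀ hx1 (by norm_num)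
    have : 1 * x ^ 11 ≤ √ω * x ^ 11 := by gcongr
    nlinarith
  have hfin : L * ‖∑ n ∈ Finset.range N, cis (ω * powThreeHalves ((n : ℝ) + 1 / 2))‖ ≤
      L * (14 * √ω * x ^ 11) := by linarith
  exact le_of_mul_le_mul_left hfin hL0

/-! ### Fourier expansion and equidistribution mod 1 -/

/-- The second Bernoulli polynomial at the fractional part of `x`. -/
noncomputable def bernoulliTwoFract (x : ℝ) : ℝ := Int.fract x ^ 2 - Int.fract x + 1 / 6

/-- The term `h = 0` vanishes because `1 / 0 = 0`; periodicity extends the expansion from `[0, 1]`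
to all `x`. -/
theorem hasSum_cos_div_sq (x : ℝ) :
    HasSum (fun h : ℕ => 1 / (h : ℝ) ^ 2 * Real.cos (2 * Real.pi * h * x))
      (Real.pi ^ 2 * bernoulliTwoFract x) := by
  have h := hasSum_one_div_nat_pow_mul_cos one_ne_zero
    (x := Int.fract x) ⟨Int.fract_nonneg x, (Int.fract_lt_one x).le⟩
  have hB : (Polynomial.map (algebraMap ℚ ℝ) (Polynomial.bernoulli (2 * 1))).eval (Int.fract x) =
      bernoulliTwoFract x := by
    simp [Polynomial.bernoulli, Finset.sum_range_succ, bernoulliTwoFract,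
      Polynomial.eval_monomial, bernoulli_eq_bernoulli'_of_ne_one]
    ring
  rw [hB] at h
  convert h using 1
  · funext k
    have : 2 * Real.pi * k * x =
        2 * Real.pi * k * Int.fract x + ((k * ⌊x⌋ : ℤ)) * (2 * Real.pi) := by
      rw [Int.fract]; push_cast; ring
    rw [this, Real.cos_add_int_mul_two_pi, mul_one]
  · rw [show Nat.factorial (2 * 1) = 2 from rfl]
    push_cast
    ring

theorem exists_abs_sum_bernoulliTwoFract_le {κ : ℝ} (hκ : 1 ≤ 2 * Real.pi * κ) :
    ∃ K : ℝ, 0 ≤ K ∧ ∀ N : ℕ,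
      |∑ n ∈ Finset.range N, bernoulliTwoFract (κ * powThreeHalves ((n : ℝ) + 1 / 2))|
        ≤ K * (N : ℝ) ^ (11 / 12 : ℝ) := by
  have hsumm : Summable fun h : ℕ => 14 * √(2 * Real.pi * κ) * ((h : ℝ) ^ (3 / 2 : ℝ))⁻¹ :=
    (Real.summable_nat_rpow_inv.2 (by norm_num)).mul_left _
  refine ⟨∑' h : ℕ, 14 * √(2 * Real.pi * κ) * ((h : ℝ) ^ (3 / 2 : ℝ))⁻¹,
    tsum_nonneg fun h => by positivity, fun N => ?_⟩
  rcases Nat.eq_zero_or_pos N with rfl | hN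
  · simp
  have hs := hasSum_sum (s := Finset.range N) fun n _ =>
    hasSum_cos_div_sq (κ * powThreeHalves ((n : ℝ) + 1 / 2))
  rw [← Finset.mul_sum] at hs
  have hbound : ∀ h : ℕ, ‖∑ n ∈ Finset.range N, 1 / (h : ℝ) ^ 2 *
      Real.cos (2 * Real.pi * h * (κ * powThreeHalves ((n : ℝ) + 1 / 2)))‖ ≤
      14 * √(2 * Real.pi * κ) * ((h : ℝ) ^ (3 / 2 : ℝ))⁻¹ * (N : ℝ) ^ (11 / 12 : ℝ) := by
    intro h
    rcases Nat.eq_zero_or_pos h with rfl | hh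
    · simp
    have hh1 : (1 : ℝ) ≤ h := by exact_mod_cast hh
    have hh0 : (0 : ℝ) < h := by linarith
    have hω : 1 ≤ 2 * Real.pi * κ * h := by nlinarith
    have hW := norm_sum_cis_powThreeHalves_le hω hN
    have hre := (Complex.abs_re_le_norm _).trans hW
    rw [Complex.re_sum] at hre
    simp only [cis_re] at hre
    rw [← Finset.mul_sum, norm_mul, Real.norm_eq_abs, Real.norm_eq_abs,
      abs_of_nonneg (by positivity : (0 : ℝ) ≤ 1 / (h : ℝ) ^ 2)]
    have e1 : ∀ n : ℕ, 2 * Real.pi * h * (κ * powThreeHalves ((n : ℝ) + 1 / 2)) =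
        2 * Real.pi * κ * h * powThreeHalves ((n : ℝ) + 1 / 2) := fun n => by ring
    simp only [e1]
    refine (mul_le_mul_of_nonneg_left hre (by positivity)).trans (le_of_eq ?_)
    rw [Real.sqrt_mul (by linarith)]
    have e2 : 1 / (h : ℝ) ^ 2 * √(h : ℝ) = ((h : ℝ) ^ (3 / 2 : ℝ))⁻¹ := by
      rw [Real.sqrt_eq_rpow, ← Real.rpow_neg hh0.le, one_div, ← Real.rpow_natCast,
        ← Real.rpow_neg hh0.le, ← Real.rpow_add hh0]
      norm_num
    rw [← e2]
    ring
  have hle := tsum_of_norm_bounded ((hsumm.mul_right _).hasSum) hbound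
  rw [hs.tsum_eq, tsum_mul_right, norm_mul, Real.norm_eq_abs, Real.norm_eq_abs,
    abs_of_nonneg (sq_nonneg Real.pi)] at hle
  refine le_trans (le_mul_of_one_le_left (abs_nonneg _) ?_) hle
  nlinarith [Real.pi_gt_three]

/-- The distance from `x` to the nearest integer. -/
noncomputable def distInt (x : ℝ) : ℝ := |x - round x|

theorem distInt_nonneg (x : ℝ) : 0 ≤ distInt x := abs_nonneg _

theorem distInt_le_half (x : ℝ) : distInt x ≤ 1 / 2 := abs_sub_round x

theorem distInt_le (x : ℝ) (k : ℤ) : distInt x ≤ |x - k| := round_le x k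

theorem abs_distInt_sub_le (x y : ℝ) : |distInt x - distInt y| ≤ |x - y| := by
  have key : ∀ x y : ℝ, distInt x - distInt y ≤ |x - y| := by
    intro x y
    have h1 := distInt_le x (round y)
    have h2 := abs_sub_le x y (round y)
    unfold distInt at *
    linarith
  rw [abs_le]
  have := key y x
  rw [abs_sub_comm] at this
  exact ⟨by linarith, key x y⟩

/-- A triangle wave has only odd harmonics: the `2 * x` term cancels the even ones. -/
theorem distInt_sub_quarter (x : ℝ) :
    distInt x - 1 / 4 = -2 * bernoulliTwoFract x + 1 / 2 * bernoulliTwoFract (2 * x) := by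
  rw [distInt, abs_sub_round_eq_min, bernoulliTwoFract, bernoulliTwoFract]
  have h0 := Int.fract_nonneg x
  have h1 := Int.fract_lt_one x
  have hx := Int.floor_add_fract x
  rcases lt_or_ge (Int.fract x) (1 / 2) with h | h
  · have h2 : Int.fract (2 * x) = 2 * Int.fract x :=
      Int.fract_eq_iff.2 ⟨by linarith, by linarith, 2 * ⌊x⌋, by push_cast; linarith⟩
    rw [h2, min_eq_left (by linarith)]
    ring
  · have h2 : Int.fract (2 * x) = 2 * Int.fract x - 1 :=
      Int.fract_eq_iff.2 ⟨by linarith, by linarith, 2 * ⌊x⌋ + 1, by push_cast; linarith⟩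
    rw [h2, min_eq_right (by linarith)]
    ring

/-- The smooth approximation `(n + 1/2) ^ (3/2) / √3` to the square root of the `n`-th square
pyramidal number. -/
noncomputable def pyramidalRoot (n : ℕ) : ℝ := 1 / √3 * powThreeHalves ((n : ℝ) + 1 / 2)

theorem exists_abs_sum_distInt_sub_quarter_le :
    ∃ K : ℝ, 0 ≤ K ∧ ∀ N : ℕ,
      |∑ n ∈ Finset.range N, (distInt (pyramidalRoot n) - 1 / 4)|
        ≤ K * (N : ℝ) ^ (11 / 12 : ℝ) := by
  have hs3 : √3 ≤ 2 := Real.sqrt_le_iff.2 (by norm_num)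
  have hs3' : 1 / 2 ≤ 1 / √3 := one_div_le_one_div_of_le (by positivity) hs3
  have hpi := Real.pi_gt_three
  obtain ⟨K₁, hK₁, h₁⟩ := exists_abs_sum_bernoulliTwoFract_le (κ := 1 / √3) (by nlinarith)
  obtain ⟨K₂, hK₂, h₂⟩ := exists_abs_sum_bernoulliTwoFract_le (κ := 2 * (1 / √3)) (by nlinarith)
  refine ⟨2 * K₁ + 1 / 2 * K₂, by positivity, fun N => ?_⟩
  simp only [distInt_sub_quarter]
  rw [Finset.sum_add_distrib, ← Finset.mul_sum, ← Finset.mul_sum]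
  have a₁ := h₁ N
  have a₂ := h₂ N
  simp only [mul_assoc 2 (1 / √3)] at a₂
  refine (abs_add_le _ _).trans ?_
  rw [abs_mul, abs_mul]
  norm_num only [abs_neg, abs_of_pos]
  simp only [pyramidalRoot]
  linarith

/-! ### Abel summation -/

/-- By monotonicity the increments of `w` sum to `w N - w 0`, and the boundary term adds `w N`. -/
theorem abs_sum_mul_le_of_monotone {w b : ℕ → ℝ} (hw : Monotone w) (hw0 : 0 ≤ w 0) {N : ℕ} {K : ℝ}
    (hb : ∀ M ≤ N, |∑ n ∈ Finset.range M, b n| ≤ K) :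
    |∑ n ∈ Finset.range N, w n * b n| ≤ 2 * w N * K := by
  set B : ℕ → ℝ := fun M => ∑ n ∈ Finset.range M, b n with hB
  have hid : ∑ n ∈ Finset.range N, w n * b n =
      w N * B N - ∑ n ∈ Finset.range N, (w (n + 1) - w n) * B (n + 1) := by
    rw [eq_sub_iff_add_eq, ← Finset.sum_add_distrib]
    have h : ∑ n ∈ Finset.range N, (w (n + 1) * B (n + 1) - w n * B n) = w N * B N := by
      rw [Finset.sum_range_sub (fun n => w n * B n)]
      simp [hB]
    rw [← h]
    refine Finset.sum_congr rfl fun n _ => ?_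
    have hs : B (n + 1) = B n + b n := Finset.sum_range_succ b n
    rw [hs]
    ring
  have h1 : |∑ n ∈ Finset.range N, (w (n + 1) - w n) * B (n + 1)| ≤ (w N - w 0) * K := by
    rw [← Finset.sum_range_sub, Finset.sum_mul]
    refine (Finset.abs_sum_le_sum_abs _ _).trans (Finset.sum_le_sum fun n hn => ?_)
    rw [abs_mul, abs_of_nonneg (sub_nonneg.2 (hw n.le_succ))]
    exact mul_le_mul_of_nonneg_left (hb _ (Finset.mem_range.1 hn)) (sub_nonneg.2 (hw n.le_succ))
  have h2 : |w N * B N| ≤ w N * K := by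
    have hwN : 0 ≤ w N := hw0.trans (hw (Nat.zero_le N))
    rw [abs_mul, abs_of_nonneg hwN]
    exact mul_le_mul_of_nonneg_left (hb N le_rfl) hwN
  have hK : 0 ≤ K := (abs_nonneg _).trans (hb 0 (Nat.zero_le N))
  rw [hid]
  refine (abs_sub _ _).trans ?_
  nlinarith [mul_nonneg hw0 hK]

/-! ### From `a_n` to the smooth root -/

theorem cannonballDist_le (n m : ℕ) :
    cannonballDist n ≤ |(squarePyramidal n : ℝ) - (m : ℝ) ^ 2| := by
  have h := closestRoot_le (squarePyramidal n) m
  unfold cannonballDist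
  exact_mod_cast h

/-- Factor `|s ^ 2 - m ^ 2| = |s - m| * (s + m)`. For `m` nearest to `s` the second factor is `2 * s
± d`, and `d ^ 2 ≤ 1/4`. -/
theorem abs_cannonballDist_sub_le (n : ℕ) :
    |cannonballDist n - 2 * √(squarePyramidal n : ℝ) * distInt √(squarePyramidal n : ℝ)|
      ≤ 1 / 4 := by
  set s := √(squarePyramidal n : ℝ) with hs
  have hs0 : 0 ≤ s := Real.sqrt_nonneg _
  have hs2 : s ^ 2 = squarePyramidal n := Real.sq_sqrt (by positivity)
  have hd0 := distInt_nonneg s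
  have hd1 := distInt_le_half s
  set d := distInt s with hd
  have hupper : cannonballDist n ≤ 2 * s * d + 1 / 4 := by
    have hr0 : 0 ≤ round s := by
      rw [round_eq]; exact Int.floor_nonneg.2 (by linarith)
    obtain ⟨m, hm⟩ := Int.eq_ofNat_of_zero_le hr0
    have h1 := cannonballDist_le n m
    have hdm : d = |s - m| := by rw [hd, distInt, hm]; simp
    have hm0 : (0 : ℝ) ≤ m := by positivity
    rw [← hs2, show s ^ 2 - (m : ℝ) ^ 2 = (s - m) * (s + m) by ring, abs_mul, ← hdm,
      abs_of_nonneg (by linarith : 0 ≤ s + m)] at h1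
    have h2 : (m : ℝ) ≤ s + d := by
      have := neg_abs_le (s - m)
      linarith
    nlinarith
  have hlower : 2 * s * d - 1 / 4 ≤ cannonballDist n := by
    unfold cannonballDist
    set y := closestRoot (squarePyramidal n)
    have hdy : d ≤ |s - y| := by
      have := distInt_le s y
      exact_mod_cast this
    have hy0 : (0 : ℝ) ≤ y := by positivity
    rw [← hs2, show s ^ 2 - (y : ℝ) ^ 2 = (s - y) * (s + y) by ring, abs_mul,
      abs_of_nonneg (by linarith : 0 ≤ s + y)]
    rcases le_total s y with h | h
    · nlinarith
    · rw [abs_of_nonneg (by linarith)] at hdy ⊢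
      nlinarith [mul_nonneg (sub_nonneg.2 hdy) hy0, mul_nonneg (sub_nonneg.2 hdy) hs0,
        mul_nonneg (sub_nonneg.2 hdy) hd0]
  rw [abs_le]
  constructor <;> linarith

theorem pyramidalRoot_nonneg (n : ℕ) : 0 ≤ pyramidalRoot n := by
  unfold pyramidalRoot powThreeHalves
  positivity

/-- Centring at `n + 1/2` removes the quadratic term of the cubic `P_n`. -/
theorem pyramidalRoot_sq (n : ℕ) :
    pyramidalRoot n ^ 2 = squarePyramidal n + ((n : ℝ) + 1 / 2) / 12 := by
  have h : (6 : ℝ) * squarePyramidal n = 2 * n ^ 3 + 3 * n ^ 2 + n := by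
    exact_mod_cast six_mul_squarePyramidal n
  rw [pyramidalRoot, powThreeHalves, mul_pow, mul_pow, Real.sq_sqrt (by positivity), div_pow,
    Real.sq_sqrt (by norm_num)]
  linear_combination (-1 / 6) * h

theorem abs_cannonballDist_sub_pyramidalRoot_le (n : ℕ) :
    |cannonballDist n - 2 * pyramidalRoot n * distInt (pyramidalRoot n)| ≤ 2 * ((n : ℝ) + 1) := by
  have h0 := abs_cannonballDist_sub_le n
  have hs2 : √(squarePyramidal n : ℝ) ^ 2 = squarePyramidal n := Real.sq_sqrt (by positivity)
  have hg2 := pyramidalRoot_sq n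
  have hg0 := pyramidalRoot_nonneg n
  have hs0 := Real.sqrt_nonneg (squarePyramidal n : ℝ)
  set s := √(squarePyramidal n : ℝ) with hs
  set g := pyramidalRoot n with hg
  have hn : (0 : ℝ) ≤ n := by positivity
  have hsg : s ≤ g := by nlinarith
  have hprod : (g - s) * (g + s) = ((n : ℝ) + 1 / 2) / 12 := by
    linear_combination hg2 - hs2
  have hgs : g * (g - s) ≤ ((n : ℝ) + 1 / 2) / 12 := by
    rw [← hprod]
    nlinarith
  have hdiff : g - s ≤ (n : ℝ) + 1 := by
    by_contra hcon
    nlinarith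
  have hdist := abs_distInt_sub_le s g
  rw [abs_sub_comm s g, abs_of_nonneg (sub_nonneg.2 hsg)] at hdist
  have hd0 := distInt_nonneg s
  have hd1 := distInt_le_half s
  have e : cannonballDist n - 2 * g * distInt g =
      (cannonballDist n - 2 * s * distInt s) + 2 * g * (distInt s - distInt g) +
        -(2 * (g - s) * distInt s) := by ring
  rw [e]
  refine (abs_add_le _ _).trans ((add_le_add_left (abs_add_le _ _) _).trans ?_)
  have b1 : |2 * g * (distInt s - distInt g)| ≤ 2 * (((n : ℝ) + 1 / 2) / 12) := by
    rw [abs_mul, abs_of_nonneg (by positivity : 0 ≤ 2 * g)]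
    nlinarith
  have b2 : |-(2 * (g - s) * distInt s)| ≤ (n : ℝ) + 1 := by
    rw [abs_neg, abs_of_nonneg (by nlinarith)]
    nlinarith
  linarith

/-! ### The main term -/

theorem powThreeHalves_mono {s t : ℝ} (hs : 0 ≤ s) (hst : s ≤ t) :
    powThreeHalves s ≤ powThreeHalves t :=
  mul_le_mul hst (Real.sqrt_le_sqrt hst) (Real.sqrt_nonneg s) (hs.trans hst)

theorem pyramidalRoot_mono : Monotone pyramidalRoot := fun m n h => by
  have : (m : ℝ) ≤ n := by exact_mod_cast h
  exact mul_le_mul_of_nonneg_left (powThreeHalves_mono (by positivity) (by linarith))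
    (by positivity)

theorem powThreeHalves_integral_bounds {s t : ℝ} (hs : 0 ≤ s) (hst : t = s + 1) :
    powThreeHalves s ≤ 2 / 5 * (t * powThreeHalves t - s * powThreeHalves s) ∧
      2 / 5 * (t * powThreeHalves t - s * powThreeHalves s) ≤ powThreeHalves t := by
  set p := √s with hp
  set q := √t with hq
  have hp0 : 0 ≤ p := Real.sqrt_nonneg _
  have hpq : p ≤ q := Real.sqrt_le_sqrt (by linarith)
  have hp2 : p ^ 2 = s := Real.sq_sqrt hs
  have hq2 : q ^ 2 = t := Real.sq_sqrt (by linarith)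
  have h1 : q ^ 2 - p ^ 2 = 1 := by linarith
  have es : powThreeHalves s = p ^ 3 := by rw [powThreeHalves, ← hp, ← hp2]; ring_nf
  have et : powThreeHalves t = q ^ 3 := by rw [powThreeHalves, ← hq, ← hq2]; ring_nf
  rw [es, et, ← hp2, ← hq2]
  obtain ⟨r, hqr⟩ : ∃ r, q = p + r := ⟨q - p, by ring⟩
  have hr : 0 ≤ r := by linarith
  rw [hqr] at h1 ⊢
  constructor
  -- Multiplying by `q ^ 2 - p ^ 2 = 1` homogenizes; in `p` and `r` all coefficients are then
  -- nonnegative.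
  · have : 0 ≤ 2 / 5 * ((p + r) ^ 2 * (p + r) ^ 3 - p ^ 2 * p ^ 3) -
        p ^ 3 * ((p + r) ^ 2 - p ^ 2) := by
      ring_nf
      positivity
    rw [h1] at this
    linarith
  · have : 0 ≤ (p + r) ^ 3 * ((p + r) ^ 2 - p ^ 2) -
        2 / 5 * ((p + r) ^ 2 * (p + r) ^ 3 - p ^ 2 * p ^ 3) := by
      ring_nf
      positivity
    rw [h1] at this
    linarith

/-- The sample at `n + 1/2` and the integral over `[n, n + 1]` both lie between the endpoint values,
whose differences telescope. -/
theorem abs_sum_powThreeHalves_sub_le (N : ℕ) :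
    |∑ n ∈ Finset.range N, powThreeHalves ((n : ℝ) + 1 / 2) -
      2 / 5 * ((N : ℝ) * powThreeHalves N)| ≤ powThreeHalves N := by
  have e0 : powThreeHalves 0 = 0 := by simp [powThreeHalves]
  have e1 : 2 / 5 * ((N : ℝ) * powThreeHalves N) = ∑ n ∈ Finset.range N, 2 / 5 *
      (((n + 1 : ℕ) : ℝ) * powThreeHalves ((n + 1 : ℕ) : ℝ) - (n : ℝ) * powThreeHalves n) := by
    rw [← Finset.mul_sum, Finset.sum_range_sub (fun n : ℕ => (n : ℝ) * powThreeHalves n)]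
    simp
  have e2 : powThreeHalves N = ∑ n ∈ Finset.range N,
      (powThreeHalves ((n + 1 : ℕ) : ℝ) - powThreeHalves n) := by
    rw [Finset.sum_range_sub (fun n : ℕ => powThreeHalves n)]
    simp [e0]
  rw [e1, ← Finset.sum_sub_distrib, e2]
  refine (Finset.abs_sum_le_sum_abs _ _).trans (Finset.sum_le_sum fun n _ => ?_)
  have hn : (0 : ℝ) ≤ n := by positivity
  obtain ⟨b1, b2⟩ := powThreeHalves_integral_bounds (s := n) (t := ((n + 1 : ℕ) : ℝ)) hn
    (by push_cast; ring)
  have c1 := powThreeHalves_mono hn (show (n : ℝ) ≤ (n : ℝ) + 1 / 2 by linarith)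
  have c2 := powThreeHalves_mono (show (0 : ℝ) ≤ (n : ℝ) + 1 / 2 by positivity)
    (show (n : ℝ) + 1 / 2 ≤ ((n + 1 : ℕ) : ℝ) by push_cast; linarith)
  rw [abs_le]
  constructor <;> linarith

/-! ### Assembly -/

theorem cannonballDist_zero : cannonballDist 0 = 0 := by
  have h := cannonballDist_le 0 0
  have h0 : 0 ≤ cannonballDist 0 := abs_nonneg _
  simp [squarePyramidal] at h
  exact le_antisymm h h0

theorem powThreeHalves_eq_rpow {t : ℝ} (ht : 0 ≤ t) : powThreeHalves t = t ^ (3 / 2 : ℝ) := by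
  rw [powThreeHalves, Real.sqrt_eq_rpow, ← Real.rpow_one_add' ht (by norm_num)]
  norm_num

theorem exists_abs_sum_cannonballDist_sub_le :
    ∃ K : ℝ, 0 ≤ K ∧ ∀ N : ℕ, 0 < N →
      |∑ n ∈ Finset.range N, cannonballDist n - 1 / (5 * √3) * ((N : ℝ) * powThreeHalves N)|
        ≤ K * (N : ℝ) ^ (29 / 12 : ℝ) := by
  obtain ⟨K, hK, hsum⟩ := exists_abs_sum_distInt_sub_quarter_le
  -- `hA` gives `2`, twice `hB` gives `16 * K`, and the main-term error gives `1`.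
  refine ⟨16 * K + 3, by positivity, fun N hN => ?_⟩
  have hN1 : (1 : ℝ) ≤ N := by exact_mod_cast hN
  have hN0 : (0 : ℝ) < N := by linarith
  have hc : 1 / √3 ≤ 1 := by
    rw [div_le_one (by positivity)]
    exact Real.one_le_sqrt.2 (by norm_num)
  have hc0 : 0 < 1 / √3 := by positivity
  have hPN : powThreeHalves N ≤ (N : ℝ) ^ 2 := by
    rw [powThreeHalves_eq_rpow hN0.le, ← Real.rpow_natCast]
    exact Real.rpow_le_rpow_of_exponent_le hN1 (by norm_num)
  have hP2 : (N : ℝ) ^ 2 ≤ (N : ℝ) ^ (29 / 12 : ℝ) := by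
    rw [← Real.rpow_natCast]
    exact Real.rpow_le_rpow_of_exponent_le hN1 (by norm_num)
  have hA : |∑ n ∈ Finset.range N, (cannonballDist n -
      2 * pyramidalRoot n * distInt (pyramidalRoot n))| ≤ 2 * (N : ℝ) ^ 2 := by
    refine (Finset.abs_sum_le_sum_abs _ _).trans ?_
    calc _ ≤ ∑ n ∈ Finset.range N, (2 * N : ℝ) := by
          refine Finset.sum_le_sum fun n hn =>
            (abs_cannonballDist_sub_pyramidalRoot_le n).trans ?_
          have : (n : ℝ) + 1 ≤ N := by exact_mod_cast Finset.mem_range.1 hn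
          linarith
      _ = _ := by simp; ring
  have hB : |∑ n ∈ Finset.range N, pyramidalRoot n * (distInt (pyramidalRoot n) - 1 / 4)| ≤
      8 * K * (N : ℝ) ^ (29 / 12 : ℝ) := by
    refine (abs_sum_mul_le_of_monotone pyramidalRoot_mono (pyramidalRoot_nonneg 0)
      (K := K * (N : ℝ) ^ (11 / 12 : ℝ)) fun M hM => (hsum M).trans ?_).trans ?_
    · have : (M : ℝ) ≤ N := by exact_mod_cast hM
      gcongr
    · have h1 : pyramidalRoot N ≤ 4 * powThreeHalves N := by
        have h2 : powThreeHalves ((N : ℝ) + 1 / 2) ≤ powThreeHalves (4 * N) :=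
          powThreeHalves_mono (by positivity) (by linarith)
        have h3 : powThreeHalves (4 * N) = 8 * powThreeHalves N := by
          rw [powThreeHalves, powThreeHalves, Real.sqrt_mul (by norm_num),
            show (4 : ℝ) = 2 ^ 2 by norm_num, Real.sqrt_sq (by norm_num)]
          ring
        have h4 : powThreeHalves ((N : ℝ) + 1 / 2) ≤ powThreeHalves (2 * N) :=
          powThreeHalves_mono (by positivity) (by linarith)
        have h5 : powThreeHalves (2 * N) ≤ 4 * powThreeHalves N := by
          have : √(2 : ℝ) ≤ 2 := Real.sqrt_le_iff.2 (by norm_num)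
          rw [powThreeHalves, powThreeHalves, Real.sqrt_mul (by norm_num)]
          have : 0 ≤ (N : ℝ) * √N := by positivity
          nlinarith
        have h6 : 0 ≤ powThreeHalves ((N : ℝ) + 1 / 2) := by
          unfold powThreeHalves; positivity
        rw [pyramidalRoot]
        nlinarith
      have h2 : powThreeHalves N * (N : ℝ) ^ (11 / 12 : ℝ) = (N : ℝ) ^ (29 / 12 : ℝ) := by
        rw [powThreeHalves_eq_rpow hN0.le, ← Real.rpow_add hN0]
        norm_num
      rw [← h2]
      have h3 : 0 ≤ K * (N : ℝ) ^ (11 / 12 : ℝ) := by positivity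
      nlinarith
  have hC := abs_sum_powThreeHalves_sub_le N
  have hsplit : ∑ n ∈ Finset.range N, cannonballDist n -
      1 / (5 * √3) * ((N : ℝ) * powThreeHalves N) =
      ∑ n ∈ Finset.range N, (cannonballDist n -
        2 * pyramidalRoot n * distInt (pyramidalRoot n)) +
      2 * ∑ n ∈ Finset.range N, pyramidalRoot n * (distInt (pyramidalRoot n) - 1 / 4) +
      1 / 2 * (1 / √3) * (∑ n ∈ Finset.range N, powThreeHalves ((n : ℝ) + 1 / 2) -
        2 / 5 * ((N : ℝ) * powThreeHalves N)) := by
    have e1 : ∀ n : ℕ, cannonballDist n = (cannonballDist n -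
        2 * pyramidalRoot n * distInt (pyramidalRoot n)) +
        2 * (pyramidalRoot n * (distInt (pyramidalRoot n) - 1 / 4)) +
        1 / 2 * (1 / √3) * powThreeHalves ((n : ℝ) + 1 / 2) := fun n => by
      have : pyramidalRoot n = 1 / √3 * powThreeHalves ((n : ℝ) + 1 / 2) := rfl
      linear_combination (1 / 2 : ℝ) * this
    rw [Finset.sum_congr rfl fun n _ => e1 n, Finset.sum_add_distrib, Finset.sum_add_distrib,
      ← Finset.mul_sum, ← Finset.mul_sum, one_div_mul_eq_div]
    field_simp
    ring_nf
  rw [hsplit]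
  refine (abs_add_le _ _).trans ((add_le_add_left (abs_add_le _ _) _).trans ?_)
  rw [abs_mul, abs_mul (1 / 2 * (1 / √3)), abs_of_pos (by norm_num : (0 : ℝ) < 2),
    abs_of_pos (by positivity : 0 < 1 / 2 * (1 / √3))]
  have hC' := hC.trans hPN
  have : 1 / 2 * (1 / √3) * |∑ n ∈ Finset.range N, powThreeHalves ((n : ℝ) + 1 / 2) -
      2 / 5 * ((N : ℝ) * powThreeHalves N)| ≤ (N : ℝ) ^ 2 :=
    (mul_le_of_le_one_left (abs_nonneg _) (by linarith)).trans hC'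
  linarith

theorem theorem1p1 :
    ∃ C : ℝ, 0 < C ∧ ∀ x : ℝ, 1 ≤ x →
      |cannonballAverage x - 1 / (5 * Real.sqrt 3) * x ^ (3 / 2 : ℝ)|
        ≤ C * x ^ (17 / 12 : ℝ) := by
  obtain ⟨K, hK, hsum⟩ := exists_abs_sum_cannonballDist_sub_le
  refine ⟨8 * K + 8, by positivity, fun x hx => ?_⟩
  have hx0 : 0 < x := by linarith
  set N := ⌊x⌋₊ + 1 with hN
  have hS : ∑ n ∈ Finset.Icc 1 ⌊x⌋₊, cannonballDist n = ∑ n ∈ Finset.range N, cannonballDist n := by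
    rw [hN, Finset.range_eq_Ico, Finset.sum_eq_sum_Ico_succ_bot (by omega), cannonballDist_zero,
      zero_add]
    rfl
  have hxN : x ≤ N := by
    rw [hN]; push_cast; exact (Nat.lt_floor_add_one x).le
  have hNx : (N : ℝ) ≤ x + 1 := by
    have := Nat.floor_le hx0.le
    rw [hN]; push_cast; linarith
  have h := hsum N (by omega)
  have hpow : (N : ℝ) ^ (29 / 12 : ℝ) ≤ 8 * x ^ (29 / 12 : ℝ) := by
    calc (N : ℝ) ^ (29 / 12 : ℝ) ≤ (2 * x) ^ (29 / 12 : ℝ) := by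
          gcongr; linarith
      _ = 2 ^ (29 / 12 : ℝ) * x ^ (29 / 12 : ℝ) := Real.mul_rpow (by norm_num) hx0.le
      _ ≤ 2 ^ (3 : ℝ) * x ^ (29 / 12 : ℝ) := by
          gcongr <;> norm_num
      _ = _ := by norm_num
  have hmain : |(N : ℝ) * powThreeHalves N - x * powThreeHalves x| ≤ 8 * x ^ (29 / 12 : ℝ) := by
    have h0 : powThreeHalves x ≤ powThreeHalves N := powThreeHalves_mono hx0.le hxN
    have h1 : powThreeHalves N ≤ powThreeHalves (x + 1) := powThreeHalves_mono (by positivity) hNx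
    have hp : 0 ≤ powThreeHalves x := by unfold powThreeHalves; positivity
    -- The increment of `t * powThreeHalves t` over `[x, x + 1]` is at most `5/2 * 3 *
    -- powThreeHalves x`, whence the constant `8`.
    obtain ⟨-, h2⟩ := powThreeHalves_integral_bounds hx0.le rfl
    have h3 : powThreeHalves (x + 1) ≤ 3 * powThreeHalves x := by
      have a : √(x + 1) ≤ 3 / 2 * √x := by
        refine Real.sqrt_le_iff.2 ⟨by positivity, ?_⟩
        rw [mul_pow, Real.sq_sqrt hx0.le]
        linarith
      rw [powThreeHalves, powThreeHalves]
      calc (x + 1) * √(x + 1) ≤ (2 * x) * (3 / 2 * √x) := by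
            gcongr; linarith
        _ = _ := by ring
    have h4 : powThreeHalves x ≤ x ^ (29 / 12 : ℝ) := by
      rw [powThreeHalves_eq_rpow hx0.le]
      exact Real.rpow_le_rpow_of_exponent_le hx (by norm_num)
    have h5 : x * powThreeHalves x ≤ N * powThreeHalves N := by gcongr
    have h6 : N * powThreeHalves N ≤ (x + 1) * powThreeHalves (x + 1) := by
      gcongr
      exact hp.trans h0
    rw [abs_of_nonneg (by linarith)]
    linarith
  have hc : 1 / (5 * √3) ≤ 1 := by
    rw [div_le_one (by positivity)]
    have : 1 ≤ √(3 : ℝ) := Real.one_le_sqrt.2 (by norm_num)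
    linarith
  have hc0 : 0 < 1 / (5 * √3) := by positivity
  have hrp : x * x ^ (17 / 12 : ℝ) = x ^ (29 / 12 : ℝ) := by
    rw [← Real.rpow_one_add' hx0.le (by norm_num)]
    norm_num
  rw [cannonballAverage, hS, ← powThreeHalves_eq_rpow hx0.le]
  set S := ∑ n ∈ Finset.range N, cannonballDist n
  have hfin : |S - 1 / (5 * √3) * (x * powThreeHalves x)| ≤ (8 * K + 8) * x ^ (29 / 12 : ℝ) := by
    have e : S - 1 / (5 * √3) * (x * powThreeHalves x) =
        (S - 1 / (5 * √3) * (N * powThreeHalves N)) +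
        1 / (5 * √3) * (N * powThreeHalves N - x * powThreeHalves x) := by ring
    rw [e]
    refine (abs_add_le _ _).trans ?_
    rw [abs_mul, abs_of_pos hc0]
    have a := mul_le_of_le_one_left (abs_nonneg (N * powThreeHalves N - x * powThreeHalves x)) hc
    have b := mul_le_mul_of_nonneg_left hpow hK
    linarith
  have e : 1 / x * S - 1 / (5 * √3) * powThreeHalves x =
      1 / x * (S - 1 / (5 * √3) * (x * powThreeHalves x)) := by
    field_simp
  rw [e, abs_mul, abs_of_pos (by positivity), one_div_mul_eq_div, div_le_iff₀ hx0]
  calc _ ≤ (8 * K + 8) * x ^ (29 / 12 : ℝ) := hfin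
    _ = _ := by rw [← hrp]; ring
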